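/- Let $d\ge 1$ be an integer and let $S$ be the star graph consisting of an origin $0$ and, for each $j=1,\dots,d$, the states $k_j$, $k=1,2,\dots$, on the $j$-th semiaxis, with the convention $0_j=0$. Let $\alpha,\lambda,\mu>0$ and let $\{N(t),t\ge 0\}$ be a continuous-time, time-homogeneous Markov process on $S$ with $N(0)=0$ almost surely and transition rates $$q(0,1_j)=\alpha,\qquad q(k_j,(k+1)_j)=\alpha+\lambda k,\qquad q(k_j,(k-1)_j)=\mu k\qquad(k\ge 1,\ 1\le j\le d),$$ all other rates between distinct states being $0$; each state is left at a total rate equal to the sum of its rates. Put $p(u,t)=\mathbb P\{N(t)=u\}$, $P(k,t)=\sum_{j=1}^d p(k_j,t)$ for $k\ge 1$, and $$F(z,t)=p(0,t)+\sum_{k=1}^{\infty}z^kP(k,t),\qquad 0\le z\le 1,\ t\ge 0.$$ Then, for $0\le z\le 1$ and $t\ge 0$ (with one-sided derivatives at the end points of these ranges), $F$ is a solution of $$\frac{\partial F}{\partial t}(z,t)=-\alpha(d-1)(1-z)\,p(0,t)-\alpha(1-z)F(z,t)-(\lambda z-\mu)(1-z)\frac{\partial F}{\partial z}(z,t),\qquad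 F(z,0)=1,\quad F(1,t)=1,$$ and it is given by $$F(z,t)=H(t)+(d-1)\int_0^t H'(t-y)\,p(0,y)\,dy,$$ where $$H(t)=h(t,z;\lambda,\mu)=\begin{cases}\displaystyle\left[\frac{(\lambda-\mu)\,e^{-(\lambda-\mu)t}}{\lambda(1-z)-(\mu-\lambda z)\,e^{-(\lambda-\mu)t}}\right]^{\alpha/\lambda}, & \lambda\ne\mu,\\[3mm] \displaystyle\frac{1}{[1+\lambda t(1-z)]^{\alpha/\lambda}}, & \lambda=\mu,\end{cases}$$ is differentiable in $t\ge 0$, $H'$ denotes its derivative in $t$, and the integrand is integrable. Consequently, with $G(t)=1-h(t,0;\lambda,\mu)$, the probability $p(0,t)$ satisfies the Volterra integral equation $$p(0,t)=1-G(t)-(d-1)\int_0^t G'(t-y)\,p(0,y)\,dy,\qquad t>0.$$ -/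

import Mathlib

open MeasureTheory Filter Topology Set
open scoped NNReal

/-- `p t u v` is the probability of being in `v` a time `t` after having been in `u`: a
time-homogeneous transition function made of stochastic matrices. -/
structure IsTransitionFunction {S : Type*} [DecidableEq S] (p : ℝ≥0 → S → S → ℝ) : Prop where
  nonneg : ∀ t u v, 0 ≤ p t u v
  hasSum_one : ∀ t u, HasSum (fun v => p t u v) 1
  zero : ∀ u v, p 0 u v = if u = v then 1 else 0
  chapman_kolmogorov : ∀ s t u v, HasSum (fun w => p s u w * p t w v) (p (s + t) u v)

/-- The transition function `p` has the transition rates `q u v = lim_{h → 0+} p h u v / h` for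
`u ≠ v`, and every state `u` is left at the total rate `∑ v, q u v` (`q` vanishes on the
diagonal in the use below). -/
structure HasTransitionRates {S : Type*} (p : ℝ≥0 → S → S → ℝ) (q : S → S → ℝ) : Prop where
  rate : ∀ u v, u ≠ v → Tendsto (fun h : ℝ≥0 => p h u v / (h : ℝ)) (𝓝[>] 0) (𝓝 (q u v))
  exit_rate : ∀ u, Tendsto (fun h : ℝ≥0 => (1 - p h u u) / (h : ℝ)) (𝓝[>] 0) (𝓝 (∑' v, q u v))

/-- The σ-algebra generated by the process up to time `s`. -/
abbrev pastOf {Ω S : Type*} [MeasurableSpace S] (N : ℝ≥0 → Ω → S) (s : ℝ≥0) : MeasurableSpace Ω :=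
  ⨆ r : Set.Iic s, MeasurableSpace.comap (N r) inferInstance

/-- `N` is a continuous-time, time-homogeneous Markov process under `P` with discrete state space
`S` and transition rates `q`. -/
structure IsMarkovProcessWithRates {Ω S : Type*} [MeasurableSpace Ω] [MeasurableSpace S]
    [DecidableEq S] (P : Measure Ω) (N : ℝ≥0 → Ω → S) (q : S → S → ℝ) : Prop where
  measurable : ∀ t, Measurable (N t)
  markov : ∃ p : ℝ≥0 → S → S → ℝ, IsTransitionFunction p ∧ HasTransitionRates p q ∧
    ∀ (s t : ℝ≥0) (A : Set Ω), MeasurableSet[pastOf N s] A → ∀ u v : S,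
      P.real (A ∩ {ω | N s ω = u} ∩ {ω | N (s + t) ω = v})
        = P.real (A ∩ {ω | N s ω = u}) * p t u v

/-- The star graph: `d` copies of the positive integers glued to a common origin `0`.
`ray j k` is the state `(k+1)_j`, at distance `k + 1` from the origin on the `j`-th semiaxis. -/
inductive StarVertex (d : ℕ) : Type
  | origin : StarVertex d
  | ray (j : Fin d) (k : ℕ) : StarVertex d
  deriving DecidableEq

namespace StarVertex

instance (d : ℕ) : MeasurableSpace (StarVertex d) := ⊤

/-- The state `k_j`, with `0_j = 0` for every `j`. -/
def site {d : ℕ} (j : Fin d) : ℕ → StarVertex d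
  | 0 => origin
  | k + 1 => ray j k

/-- The transition rates `q(0, 1_j) = α`, `q(k_j, (k+1)_j) = α + λ k`, `q(k_j, (k-1)_j) = μ k`
for `k ≥ 1`; all other rates are zero. -/
def rate {d : ℕ} (α lam mu : ℝ) : StarVertex d → StarVertex d → ℝ
  | origin, origin => 0
  | origin, ray _ l => if l = 0 then α else 0
  | ray _ k, origin => if k = 0 then mu else 0
  | ray i k, ray j l =>
      if i = j ∧ l = k + 1 then α + lam * ((k : ℝ) + 1)
      else if i = j ∧ k = l + 1 then mu * ((k : ℝ) + 1)
      else 0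

end StarVertex

/-- `N` is the birth-death process with immigration on the star graph, started at the origin. -/
structure IsStarWalk {Ω : Type*} [MeasurableSpace Ω] {d : ℕ} (P : Measure Ω) (α lam mu : ℝ)
    (N : ℝ≥0 → Ω → StarVertex d) : Prop where
  markov : IsMarkovProcessWithRates P N (StarVertex.rate α lam mu)
  start : ∀ᵐ ω ∂P, N 0 ω = StarVertex.origin

noncomputable section

/-- The state probability `p(u, t) = P(N(t) = u)` for `t ≥ 0`. -/
def stateProb {Ω : Type*} [MeasurableSpace Ω] {d : ℕ} (P : Measure Ω)
    (N : ℝ≥0 → Ω → StarVertex d) (u : StarVertex d) (t : ℝ) : ℝ :=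
  P.real {ω | N t.toNNReal ω = u}

/-- `P(k, t) = ∑ j, p(k_j, t)`, used for `k ≥ 1`. -/
def levelProb {Ω : Type*} [MeasurableSpace Ω] {d : ℕ} (P : Measure Ω)
    (N : ℝ≥0 → Ω → StarVertex d) (k : ℕ) (t : ℝ) : ℝ :=
  ∑ j : Fin d, stateProb P N (StarVertex.site j k) t

/-- The generating function `F(z, t) = p(0, t) + ∑_{k ≥ 1} z ^ k P(k, t)`. -/
def genFun {Ω : Type*} [MeasurableSpace Ω] {d : ℕ} (P : Measure Ω)
    (N : ℝ≥0 → Ω → StarVertex d) (z t : ℝ) : ℝ :=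
  stateProb P N StarVertex.origin t + ∑' k : ℕ, z ^ (k + 1) * levelProb P N (k + 1) t

/-- The explicit function `h(t, z; λ, μ)`. For `λ ≠ μ` the power is taken of the quotient, which is
positive for `t ≥ 0`, `0 ≤ z ≤ 1`; for `λ < μ` both its numerator and its denominator are
negative. -/
def hFun (α lam mu t z : ℝ) : ℝ :=
  if lam = mu then 1 / (1 + lam * t * (1 - z)) ^ (α / lam)
  else ((lam - mu) * Real.exp (-(lam - mu) * t) /
    (lam * (1 - z) - (mu - lam * z) * Real.exp (-(lam - mu) * t))) ^ (α / lam)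

/-- `G(t) = 1 - h(t, 0; λ, μ)`. -/
def GFun (α lam mu t : ℝ) : ℝ := 1 - hFun α lam mu t 0

end

/-! ### Bounded solutions of the backward equation -/

section Semigroup

/-! The rates alone give only Kolmogorov's backward equation. Since the rates out of a state add up
to its exit rate, jumps outside the finite neighbourhood have probability `o(h)`, so `P_t f` has
right derivative `Q P_t f` for bounded `f`; continuity turns this into an integral equation.

The differential equation for `F` is a forward equation, obtained by uniqueness. If `f` and `Qf` are
bounded, then `P_t f` and `f + ∫ P_s Qf` are locally bounded solutions of the same backward problem.
They agree by a maximum principle (`nonpos_of_backward_subsolution`), with `1 + level` as Lyapunov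
function since the rates grow linearly. The same principle shows that the distance from the origin
has finite mean, which gives the derivative in `z` up to `z = 1`. Taking `f = z ^ level` with `|z| <
1` yields the equation for `F`; at `z = 1` it is trivial because `F = 1`.

The formula comes from characteristics. Let `g` solve `g' = (μ - λ g)(1 - g)`, `g(0) = z`; then `H'
= -α (1 - g) H` and `H(0) = 1`. In the derivative of `y ↦ H(t - y) F(g(t - y), y)` the terms in `F`
and `∂F/∂z` cancel, leaving `(d - 1) H'(t - y) p(0, y)`. Integrating over `[0, t]` gives the
formula, and `z = 0` gives the Volterra equation. -/

theorem abs_sub_le_two_mul {S : Type*} {f : S → ℝ} {C : ℝ} (hf : ∀ y, |f y| ≤ C) (x y : S) :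
    |f y - f x| ≤ 2 * C := by
  have := abs_sub (f y) (f x)
  linarith [hf x, hf y]

/-- The action of a transition function on functions: `P_t f (x) = ∑ y, p t x y * f y`. -/
noncomputable def semigroupApply {S : Type*} (p : ℝ≥0 → S → S → ℝ) (f : S → ℝ) (t : ℝ) (x : S) : ℝ :=
  ∑' y, p t.toNNReal x y * f y

/-- The generator of a chain with rates `q` and finite neighbourhoods `nb`. -/
def generatorApply {S : Type*} (q : S → S → ℝ) (nb : S → Finset S) (f : S → ℝ) (x : S) : ℝ :=
  ∑ y ∈ nb x, q x y * (f y - f x)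

theorem continuous_generatorApply {S : Type*} {q : S → S → ℝ} {nb : S → Finset S}
    {f : ℝ → S → ℝ} (hf : ∀ x, Continuous fun t => f t x) (x : S) :
    Continuous fun t => generatorApply q nb (f t) x :=
  continuous_finsetSum _ fun y _ => continuous_const.mul ((hf y).sub (hf x))

variable {S : Type*} [DecidableEq S] {p : ℝ≥0 → S → S → ℝ} {q : S → S → ℝ} {nb : S → Finset S}

theorem IsTransitionFunction.summable_mul (hp : IsTransitionFunction p) {f : S → ℝ} {C : ℝ}
    (hf : ∀ y, |f y| ≤ C) (t : ℝ≥0) (x : S) : Summable fun y => p t x y * f y := by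
  refine Summable.of_norm_bounded (g := fun y => p t x y * C)
    ((hp.hasSum_one t x).summable.mul_right C) fun y => ?_
  rw [Real.norm_eq_abs, abs_mul, abs_of_nonneg (hp.nonneg t x y)]
  exact mul_le_mul_of_nonneg_left (hf y) (hp.nonneg t x y)

theorem IsTransitionFunction.abs_semigroupApply_le (hp : IsTransitionFunction p) {f : S → ℝ}
    {C : ℝ} (hf : ∀ y, |f y| ≤ C) (t : ℝ) (x : S) : |semigroupApply p f t x| ≤ C := by
  have h := (hp.hasSum_one t.toNNReal x).mul_right C
  rw [one_mul] at h
  refine tsum_of_norm_bounded (f := fun y => p t.toNNReal x y * f y) h fun y => ?_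
  rw [Real.norm_eq_abs, abs_mul, abs_of_nonneg (hp.nonneg _ x y)]
  exact mul_le_mul_of_nonneg_left (hf y) (hp.nonneg _ x y)

theorem IsTransitionFunction.semigroupApply_of_nonpos (hp : IsTransitionFunction p) (f : S → ℝ)
    {t : ℝ} (ht : t ≤ 0) (x : S) : semigroupApply p f t x = f x := by
  simp [semigroupApply, Real.toNNReal_of_nonpos ht, hp.zero]

theorem IsTransitionFunction.semigroupApply_add (hp : IsTransitionFunction p) {f : S → ℝ} {C : ℝ}
    (hf : ∀ y, |f y| ≤ C) {s t : ℝ} (hs : 0 ≤ s) (ht : 0 ≤ t) (x : S) :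
    semigroupApply p f (s + t) x = semigroupApply p (semigroupApply p f t) s x := by
  have h2 : ∀ y, HasSum (fun w => p s.toNNReal x w * p t.toNNReal w y)
      (p (s + t).toNNReal x y) := fun y => by
    rw [Real.toNNReal_add hs ht]; exact hp.chapman_kolmogorov _ _ x y
  have hsum : Summable (Function.uncurry fun w y =>
      p s.toNNReal x w * (p t.toNNReal w y * f y)) := by
    have h0 : 0 ≤ C := (abs_nonneg _).trans (hf x)
    -- Replacing `f` by its bound gives a nonnegative double series with finite iterated sums, which
    -- dominates and so permits the exchange of summations.
    have hC : Summable (fun z : S × S => p s.toNNReal x z.1 * (p t.toNNReal z.1 z.2 * C)) := by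
      refine (summable_prod_of_nonneg (f := fun z : S × S =>
        p s.toNNReal x z.1 * (p t.toNNReal z.1 z.2 * C)) fun z => mul_nonneg (hp.nonneg _ _ _)
        (mul_nonneg (hp.nonneg _ _ _) h0)).2
        ⟨fun w => ((hp.hasSum_one t.toNNReal w).summable.mul_right C).mul_left (p s.toNNReal x w), ?_⟩
      have h3 : ∀ w, ∑' y, p s.toNNReal x w * (p t.toNNReal w y * C) = p s.toNNReal x w * C :=
        fun w => by rw [tsum_mul_left, tsum_mul_right, (hp.hasSum_one _ _).tsum_eq, one_mul]
      simp only [h3]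
      exact (hp.hasSum_one s.toNNReal x).summable.mul_right C
    refine Summable.of_norm_bounded hC fun z => ?_
    rw [Function.uncurry, Real.norm_eq_abs, abs_mul, abs_mul,
      abs_of_nonneg (hp.nonneg s.toNNReal x z.1), abs_of_nonneg (hp.nonneg t.toNNReal z.1 z.2)]
    exact mul_le_mul_of_nonneg_left
      (mul_le_mul_of_nonneg_left (hf _) (hp.nonneg _ _ _)) (hp.nonneg _ _ _)
  unfold semigroupApply
  simp_rw [← tsum_mul_left]
  rw [← hsum.tsum_comm]
  refine tsum_congr fun y => ?_
  rw [← (h2 y).tsum_eq, ← tsum_mul_right]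
  exact tsum_congr fun w => by ring

/-- The rows have mass one, so the mass outside `s` is the factor multiplying `K`. This controls the
tail of the infinite sum uniformly. -/
theorem IsTransitionFunction.abs_tsum_sub_sum_le (hp : IsTransitionFunction p) {g : S → ℝ} {K : ℝ}
    (hg : ∀ y, |g y| ≤ K) (t : ℝ≥0) (x : S) (s : Finset S) :
    |∑' y, p t x y * g y - ∑ y ∈ s, p t x y * g y| ≤ (1 - ∑ y ∈ s, p t x y) * K := by
  have hs : ∀ a : S → ℝ, HasSum (fun y => if y ∈ s then a y else 0) (∑ y ∈ s, a y) := fun a => by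
    have h := hasSum_sum_of_ne_finset_zero (L := .unconditional S)
      (f := fun y => if y ∈ s then a y else 0) (s := s) (fun y hy => if_neg hy)
    rwa [Finset.sum_congr rfl fun y hy => if_pos hy] at h
  have h1 := ((hp.summable_mul hg t x).hasSum.sub (hs fun y => p t x y * g y))
  have h2 := ((hp.hasSum_one t x).sub (hs (p t x))).mul_right K
  rw [← h1.tsum_eq, ← Real.norm_eq_abs]
  refine tsum_of_norm_bounded h2 fun y => ?_
  by_cases hy : y ∈ s
  · simp [hy]
  · simp only [hy, if_false, sub_zero, Real.norm_eq_abs, abs_mul, abs_of_nonneg (hp.nonneg _ _ _)]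
    exact mul_le_mul_of_nonneg_left (hg y) (hp.nonneg _ _ _)

theorem IsTransitionFunction.tsum_mul_sub (hp : IsTransitionFunction p) {f : S → ℝ} {C : ℝ}
    (hf : ∀ y, |f y| ≤ C) (t : ℝ≥0) (x : S) :
    ∑' y, p t x y * (f y - f x) = ∑' y, p t x y * f y - f x := by
  have h := (hp.summable_mul hf t x).hasSum.sub ((hp.hasSum_one t x).mul_right (f x))
  rw [one_mul] at h
  rw [← h.tsum_eq]
  exact tsum_congr fun y => by ring

theorem IsTransitionFunction.abs_semigroupApply_sub_le (hp : IsTransitionFunction p) {f : S → ℝ}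
    {C : ℝ} (hf : ∀ y, |f y| ≤ C) (t : ℝ) (x : S) :
    |semigroupApply p f t x - f x| ≤ (1 - p t.toNNReal x x) * (2 * C) := by
  have h := hp.abs_tsum_sub_sum_le (abs_sub_le_two_mul hf x) t.toNNReal x {x}
  simpa [hp.tsum_mul_sub hf, semigroupApply] using h

theorem HasTransitionRates.tendsto_one_sub (hp : IsTransitionFunction p)
    (hq : HasTransitionRates p q) (x : S) :
    Tendsto (fun h : ℝ≥0 => 1 - p h x x) (𝓝 0) (𝓝 0) := by
  have h1 : Tendsto (fun h : ℝ≥0 => 1 - p h x x) (𝓝[>] 0) (𝓝 0) := by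
    have h := (hq.exit_rate x).mul
      ((NNReal.continuous_coe.tendsto (0 : ℝ≥0)).mono_left (nhdsWithin_le_nhds (s := Ioi 0)))
    rw [NNReal.coe_zero, mul_zero] at h
    refine h.congr' ?_
    filter_upwards [self_mem_nhdsWithin] with h hh
    have : (h : ℝ) ≠ 0 := by exact_mod_cast (ne_of_gt hh)
    field_simp
  have h2 : (𝓝 (0 : ℝ≥0)) = pure 0 ⊔ 𝓝[>] 0 := by
    rw [← nhdsWithin_singleton, ← nhdsWithin_union, ← nhdsWithin_univ]
    congr 1
    ext z
    simp
  rw [h2, tendsto_sup]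
  refine ⟨?_, h1⟩
  have h0 : (1 : ℝ) - p 0 x x = 0 := by simp [hp.zero]
  rw [tendsto_pure_left]
  intro s hs
  rw [h0]
  exact mem_of_mem_nhds hs

/-- By the semigroup law an increment over a time `h` is at most `2 * C` times the probability of
not being in `x` at time `h`, which tends to zero. Negative times count as time `0`, whence `max t
0` and continuity on the whole line. -/
theorem IsTransitionFunction.continuous_semigroupApply (hp : IsTransitionFunction p)
    (hq : HasTransitionRates p q) {f : S → ℝ} {C : ℝ} (hf : ∀ y, |f y| ≤ C) (x : S) :
    Continuous fun t => semigroupApply p f t x := by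
  have key : ∀ s t : ℝ, 0 ≤ s → s ≤ t → |semigroupApply p f t x - semigroupApply p f s x|
      ≤ (1 - p (t - s).toNNReal x x) * (2 * C) := fun s t hs hst => by
    have h := hp.abs_semigroupApply_sub_le (fun y => hp.abs_semigroupApply_le hf s y) (t - s) x
    rwa [← hp.semigroupApply_add hf (sub_nonneg.2 hst) hs, sub_add_cancel] at h
  have hmax : ∀ t, semigroupApply p f t x = semigroupApply p f (max t 0) x := fun t => by
    rcases le_total t 0 with h | h <;> simp [semigroupApply, h, Real.toNNReal_of_nonpos]
  have key2 : ∀ s t : ℝ, |semigroupApply p f t x - semigroupApply p f s x|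
      ≤ (1 - p (|max t 0 - max s 0|).toNNReal x x) * (2 * C) := fun s t => by
    rw [hmax s, hmax t]
    rcases le_total (max s 0) (max t 0) with h | h
    · rw [abs_of_nonneg (sub_nonneg.2 h)]
      exact key _ _ (le_max_right _ _) h
    · rw [abs_sub_comm, abs_sub_comm (max t 0), abs_of_nonneg (sub_nonneg.2 h)]
      exact key _ _ (le_max_right _ _) h
  rw [continuous_iff_continuousAt]
  intro s
  rw [ContinuousAt, tendsto_iff_norm_sub_tendsto_zero]
  refine squeeze_zero (fun _ => norm_nonneg _) (key2 s) ?_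
  have h1 : Tendsto (fun t : ℝ => (|max t 0 - max s 0|).toNNReal) (𝓝 s) (𝓝 0) := by
    have : Continuous fun t : ℝ => (|max t 0 - max s 0|).toNNReal := by fun_prop
    simpa using this.tendsto s
  simpa using ((hq.tendsto_one_sub hp x).comp h1).mul_const (2 * C)

theorem HasTransitionRates.tendsto_slope (hp : IsTransitionFunction p)
    (hq : HasTransitionRates p q) (hnb : ∀ x y, y ∉ nb x → q x y = 0) (hself : ∀ x, x ∉ nb x)
    {f : S → ℝ} {C : ℝ} (hf : ∀ y, |f y| ≤ C) (x : S) :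
    Tendsto (fun h : ℝ≥0 => (∑' y, p h x y * f y - f x) / (h : ℝ)) (𝓝[>] 0)
      (𝓝 (generatorApply q nb f x)) := by
  have hA : Tendsto (fun h : ℝ≥0 => ∑ y ∈ nb x, p h x y / (h : ℝ) * (f y - f x)) (𝓝[>] 0)
      (𝓝 (generatorApply q nb f x)) :=
    tendsto_finsetSum _ fun y hy =>
      (hq.rate x y fun h => hself x (h ▸ hy)).mul_const _
  -- The probability of being outside `x` and its neighbours is `o(h)`, because the exit rate equals
  -- the sum of the rates to the neighbours.
  have hB : Tendsto (fun h : ℝ≥0 => ((1 - p h x x) / (h : ℝ) - ∑ y ∈ nb x, p h x y / (h : ℝ))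
      * (2 * C)) (𝓝[>] 0) (𝓝 0) := by
    have h := ((hq.exit_rate x).sub (tendsto_finsetSum (nb x) fun y hy =>
      (hq.rate x y fun h => hself x (h ▸ hy)))).mul_const (2 * C)
    rwa [tsum_eq_sum (s := nb x) fun y hy => hnb x y hy, sub_self, zero_mul] at h
  have hAB : Tendsto (fun h : ℝ≥0 => (∑' y, p h x y * f y - f x) / (h : ℝ)
      - ∑ y ∈ nb x, p h x y / (h : ℝ) * (f y - f x)) (𝓝[>] 0) (𝓝 0) := by
    refine squeeze_zero_norm' ?_ hB
    filter_upwards [self_mem_nhdsWithin] with h hh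
    have hpos : (0 : ℝ) < h := by exact_mod_cast hh
    have h := hp.abs_tsum_sub_sum_le (abs_sub_le_two_mul hf x) h x (insert x (nb x))
    rw [hp.tsum_mul_sub hf, Finset.sum_insert (hself x), Finset.sum_insert (hself x), sub_self,
      mul_zero, zero_add] at h
    simp_rw [div_mul_eq_mul_div, ← Finset.sum_div, ← sub_div, Real.norm_eq_abs, abs_div,
      abs_of_pos hpos, div_mul_eq_mul_div]
    gcongr
    rwa [sub_sub, ← sub_sub, sub_sub (1 : ℝ)]
  simpa using hAB.add hA

/-- Writing `P_(t+h) f = P_h (P_t f)` reduces to time zero with the bounded function `P_t f`. This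
splitting gives only the right derivative. -/
theorem HasTransitionRates.hasDerivWithinAt_semigroupApply (hp : IsTransitionFunction p)
    (hq : HasTransitionRates p q) (hnb : ∀ x y, y ∉ nb x → q x y = 0) (hself : ∀ x, x ∉ nb x)
    {f : S → ℝ} {C : ℝ} (hf : ∀ y, |f y| ≤ C) (x : S) {t : ℝ} (ht : 0 ≤ t) :
    HasDerivWithinAt (fun t => semigroupApply p f t x)
      (generatorApply q nb (semigroupApply p f t) x) (Ioi t) t := by
  rw [hasDerivWithinAt_iff_tendsto_slope' (by simp)]
  have h := hq.tendsto_slope hp hnb hself (fun y => hp.abs_semigroupApply_le hf t y) x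
  have h1 : Tendsto (fun r : ℝ => (r - t).toNNReal) (𝓝[>] t) (𝓝[>] 0) := by
    refine tendsto_nhdsWithin_iff.2 ⟨?_, ?_⟩
    · have : Continuous fun r : ℝ => (r - t).toNNReal := by fun_prop
      simpa using (this.tendsto t).mono_left nhdsWithin_le_nhds
    · filter_upwards [self_mem_nhdsWithin] with r hr
      simpa using hr
  refine (h.comp h1).congr' ?_
  filter_upwards [self_mem_nhdsWithin] with r hr
  have hr' : 0 ≤ r - t := sub_nonneg.2 (le_of_lt hr)
  have h2 := hp.semigroupApply_add hf hr' ht x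
  rw [sub_add_cancel] at h2
  rw [slope_def_field, h2, Function.comp, Real.coe_toNNReal _ hr']
  rfl

/-- Kolmogorov's backward equation for bounded initial values. -/
theorem HasTransitionRates.semigroupApply_eq_integral (hp : IsTransitionFunction p)
    (hq : HasTransitionRates p q) (hnb : ∀ x y, y ∉ nb x → q x y = 0) (hself : ∀ x, x ∉ nb x)
    {f : S → ℝ} {C : ℝ} (hf : ∀ y, |f y| ≤ C) (x : S) {t : ℝ} (ht : 0 ≤ t) :
    semigroupApply p f t x
      = f x + ∫ s in (0 : ℝ)..t, generatorApply q nb (semigroupApply p f s) x := by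
  have hc := fun y => hp.continuous_semigroupApply hq hf y
  rw [intervalIntegral.integral_eq_sub_of_hasDeriv_right_of_le ht (hc x).continuousOn
    (fun s hs => hq.hasDerivWithinAt_semigroupApply hp hnb hself hf x hs.1.le)
    ((continuous_generatorApply hc x).intervalIntegrable _ _),
    hp.semigroupApply_of_nonpos f le_rfl]
  ring

theorem HasTransitionRates.hasDerivAt_semigroupApply (hp : IsTransitionFunction p)
    (hq : HasTransitionRates p q) (hnb : ∀ x y, y ∉ nb x → q x y = 0) (hself : ∀ x, x ∉ nb x)
    {f : S → ℝ} {C : ℝ} (hf : ∀ y, |f y| ≤ C) (x : S) {t : ℝ} (ht : 0 < t) :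
    HasDerivAt (fun t => semigroupApply p f t x)
      (generatorApply q nb (semigroupApply p f t) x) t := by
  have hc := continuous_generatorApply (q := q) (nb := nb)
    (fun y => hp.continuous_semigroupApply hq hf y) x
  have h := (intervalIntegral.integral_hasDerivAt_right (hc.intervalIntegrable 0 t)
    hc.stronglyMeasurable.stronglyMeasurableAtFilter hc.continuousAt).const_add (f x)
  refine h.congr_of_eventuallyEq ?_
  filter_upwards [lt_mem_nhds ht] with s hs
  exact hq.semigroupApply_eq_integral hp hnb hself hf x hs.le

end Semigroup

/-! ### The maximum principle and the forward equation -/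

section Comparison

theorem generatorApply_sub_mul {S : Type*} (q : S → S → ℝ) (nb : S → Finset S) (f g : S → ℝ)
    (a : ℝ) (x : S) : generatorApply q nb (fun y => f y - a * g y) x
      = generatorApply q nb f x - a * generatorApply q nb g x := by
  simp only [generatorApply, Finset.mul_sum, ← Finset.sum_sub_distrib]
  exact Finset.sum_congr rfl fun y _ => by ring

theorem HasDerivAt.nonneg_of_isMaxOn_left {f : ℝ → ℝ} {f' a t : ℝ} (hf : HasDerivAt f f' t)
    (hat : a < t) (hmax : ∀ s ∈ Ioo a t, f s ≤ f t) : 0 ≤ f' := by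
  have h := (hasDerivWithinAt_iff_tendsto_slope' (s := Iio t) (by simp)).1 hf.hasDerivWithinAt
  refine ge_of_tendsto h ?_
  filter_upwards [Ioo_mem_nhdsLT hat] with s hs
  rw [slope_def_field]
  exact div_nonneg_of_nonpos (sub_nonpos.2 (hmax s hs)) (sub_nonpos.2 hs.2.le)

/-- Maximum principle: in the presence of a Lyapunov function `w` with finite sublevel sets, a
subsolution of the backward equation which is bounded above and nonpositive at time `0` stays
nonpositive. -/
theorem nonpos_of_backward_subsolution {S : Type*} {q : S → S → ℝ} {nb : S → Finset S}
    {w : S → ℝ} {c : ℝ} (hc : 0 ≤ c) (hw : ∀ M, {x | w x ≤ M}.Finite) (hw0 : ∀ x, 0 < w x)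
    (hQw : ∀ x, generatorApply q nb w x ≤ c * w x) (hq0 : ∀ x y, 0 ≤ q x y)
    {T C : ℝ} {v v' : ℝ → S → ℝ} (hcont : ∀ x, Continuous fun t => v t x)
    (hv : ∀ t ∈ Ioc 0 T, ∀ x, HasDerivAt (fun t => v t x) (v' t x) t)
    (hle : ∀ t ∈ Ioc 0 T, ∀ x, v' t x ≤ generatorApply q nb (v t) x)
    (hC : ∀ t ∈ Icc 0 T, ∀ x, v t x ≤ C) (h0 : ∀ x, v 0 x ≤ 0) (hT : 0 ≤ T) (x : S) :
    v T x ≤ 0 := by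
  by_contra! hpos
  -- With this `ε` half of `v T x` survives the perturbation, so `W T x > 0`. The rate `c + 1`
  -- instead of `c` makes the final inequality strict.
  set ε : ℝ := v T x / (2 * (Real.exp ((c + 1) * T) * w x)) with hε
  have hε0 : 0 < ε := by have := hw0 x; positivity
  set W : ℝ → S → ℝ := fun t y => v t y - ε * Real.exp ((c + 1) * t) * w y with hW
  have hWx : W T x = v T x / 2 := by
    have := (hw0 x).ne'
    have := (Real.exp_pos ((c + 1) * T)).ne'
    simp only [hW, hε]
    field_simp
    ring
  have hexp : ∀ t ∈ Icc 0 T, ∀ y, ε * w y ≤ ε * Real.exp ((c + 1) * t) * w y := fun t ht y => by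
    have h1 : 1 ≤ Real.exp ((c + 1) * t) :=
      Real.one_le_exp (mul_nonneg (by linarith) ht.1)
    have := mul_le_mul_of_nonneg_right h1 (mul_pos hε0 (hw0 y)).le
    linarith
  have hTmem : T ∈ Icc 0 T := ⟨hT, le_rfl⟩
  -- Outside this finite set `W` is negative on `[0, T]`. Hence a positive maximum of `W` over time
  -- and space is attained.
  have hfin : {y | ε * w y ≤ C}.Finite := by
    refine (hw (C / ε)).subset fun y hy => ?_
    rw [mem_ofPred_eq, le_div_iff₀ hε0, mul_comm]
    exact hy
  have hxK : x ∈ hfin.toFinset := by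
    rw [Finite.mem_toFinset, mem_ofPred_eq]
    have h1 := hexp T hTmem x
    have h2 := hC T hTmem x
    have h3 : v T x - ε * Real.exp ((c + 1) * T) * w x = v T x / 2 := hWx
    linarith
  have hWc : ∀ y, Continuous fun t => W t y := fun y => by
    have := hcont y
    simp only [hW]
    fun_prop
  have hex : ∀ y, ∃ t ∈ Icc 0 T, ∀ s ∈ Icc 0 T, W s y ≤ W t y := fun y =>
    isCompact_Icc.exists_isMaxOn ⟨T, hTmem⟩ (hWc y).continuousOn
  choose τ hτ hτmax using hex
  obtain ⟨y, -, hymax⟩ := hfin.toFinset.exists_max_image (fun y => W (τ y) y) ⟨x, hxK⟩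
  have hWy : 0 < W (τ y) y := by
    have h1 := hymax x hxK
    have h2 := hτmax x T hTmem
    linarith
  have hall : ∀ z, W (τ y) z ≤ W (τ y) y := fun z => by
    by_cases hz : z ∈ hfin.toFinset
    · exact (hτmax z _ (hτ y)).trans (hymax z hz)
    · rw [Finite.mem_toFinset, mem_ofPred_eq, not_le] at hz
      have h1 := hexp _ (hτ y) z
      have h2 := hC _ (hτ y) z
      have h3 : W (τ y) z = v (τ y) z - ε * Real.exp ((c + 1) * τ y) * w z := rfl
      linarith
  have hτ0 : 0 < τ y := by
    refine lt_of_le_of_ne (hτ y).1 fun h => ?_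
    rw [← h] at hWy
    have h3 : W 0 y = v 0 y - ε * Real.exp ((c + 1) * 0) * w y := rfl
    have h4 := hexp 0 ⟨le_rfl, hT⟩ y
    have h5 := mul_pos hε0 (hw0 y)
    linarith [h0 y]
  have hmem : τ y ∈ Ioc 0 T := ⟨hτ0, (hτ y).2⟩
  have hder : HasDerivAt (fun t => W t y)
      (v' (τ y) y - ε * (Real.exp ((c + 1) * τ y) * (c + 1)) * w y) (τ y) := by
    have h1 : HasDerivAt (fun t => Real.exp ((c + 1) * t))
        (Real.exp ((c + 1) * τ y) * (c + 1)) (τ y) := by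
      simpa using ((hasDerivAt_id (τ y)).const_mul (c + 1)).exp
    exact (hv _ hmem y).sub ((h1.const_mul ε).mul_const (w y))
  have hnn := hder.nonneg_of_isMaxOn_left hτ0 fun s hs =>
    hτmax y s ⟨hs.1.le, hs.2.le.trans (hτ y).2⟩
  have hgen : generatorApply q nb (W (τ y)) y ≤ 0 :=
    Finset.sum_nonpos fun z _ =>
      mul_nonpos_of_nonneg_of_nonpos (hq0 y z) (sub_nonpos.2 (hall z))
  have hgen2 := generatorApply_sub_mul q nb (v (τ y)) w (ε * Real.exp ((c + 1) * τ y)) y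
  rw [show (fun z => v (τ y) z - ε * Real.exp ((c + 1) * τ y) * w z) = W (τ y) from rfl] at hgen2
  have h6 := hle _ hmem y
  have h7 : 0 < ε * Real.exp ((c + 1) * τ y) := mul_pos hε0 (Real.exp_pos _)
  have h8 := mul_le_mul_of_nonneg_left (hQw y) h7.le
  have h9 := mul_pos h7 (hw0 y)
  -- At the maximum the time derivative of `W` is nonnegative and `Q W ≤ 0`. Yet the derivative is
  -- at most `Q W - ε * exp ((c + 1) * τ y) * w y < 0`.
  linarith

variable {S : Type*} [DecidableEq S] {p : ℝ≥0 → S → S → ℝ} {q : S → S → ℝ} {nb : S → Finset S}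

/-- Bounded functions below a Lyapunov function stay below its exponential growth. -/
theorem HasTransitionRates.semigroupApply_le_exp_mul (hp : IsTransitionFunction p)
    (hq : HasTransitionRates p q) (hnb : ∀ x y, y ∉ nb x → q x y = 0) (hself : ∀ x, x ∉ nb x)
    {w : S → ℝ} {c : ℝ} (hc : 0 ≤ c) (hw : ∀ M, {x | w x ≤ M}.Finite) (hw0 : ∀ x, 0 < w x)
    (hQw : ∀ x, generatorApply q nb w x ≤ c * w x) (hq0 : ∀ x y, 0 ≤ q x y)
    {f : S → ℝ} {C : ℝ} (hf : ∀ y, |f y| ≤ C) (hfw : ∀ y, f y ≤ w y) {t : ℝ} (ht : 0 ≤ t) (x : S) :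
    semigroupApply p f t x ≤ Real.exp (c * t) * w x := by
  have h := nonpos_of_backward_subsolution (q := q) (nb := nb) (T := t) (C := C)
    (v := fun s y => semigroupApply p f s y - Real.exp (c * s) * w y)
    (v' := fun s y => generatorApply q nb (semigroupApply p f s) y
      - Real.exp (c * s) * c * w y) hc hw hw0 hQw hq0
    (fun y => (hp.continuous_semigroupApply hq hf y).sub (by fun_prop))
    (fun s hs y => by
      have h1 : HasDerivAt (fun t => Real.exp (c * t)) (Real.exp (c * s) * c) s := by
        simpa using ((hasDerivAt_id s).const_mul c).exp
      exact (hq.hasDerivAt_semigroupApply hp hnb hself hf y hs.1).sub (h1.mul_const _))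
    (fun s _ y => by
      rw [generatorApply_sub_mul]
      have := mul_le_mul_of_nonneg_left (hQw y) (Real.exp_pos (c * s)).le
      linarith)
    (fun s _ y => by
      have h1 := (abs_le.1 (hp.abs_semigroupApply_le hf s y)).2
      have h2 := mul_pos (Real.exp_pos (c * s)) (hw0 y)
      linarith)
    (fun y => by simpa [hp.semigroupApply_of_nonpos] using hfw y) ht x
  linarith

/-- Kolmogorov's forward equation in weak form (Dynkin's formula). -/
theorem HasTransitionRates.semigroupApply_eq_integral_generatorApply (hp : IsTransitionFunction p)
    (hq : HasTransitionRates p q) (hnb : ∀ x y, y ∉ nb x → q x y = 0) (hself : ∀ x, x ∉ nb x)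
    {w : S → ℝ} {c : ℝ} (hc : 0 ≤ c) (hw : ∀ M, {x | w x ≤ M}.Finite) (hw0 : ∀ x, 0 < w x)
    (hQw : ∀ x, generatorApply q nb w x ≤ c * w x) (hq0 : ∀ x y, 0 ≤ q x y)
    {f : S → ℝ} {C : ℝ} (hf : ∀ y, |f y| ≤ C) {C' : ℝ} (hQf : ∀ y, |generatorApply q nb f y| ≤ C')
    {t : ℝ} (ht : 0 ≤ t) (x : S) :
    semigroupApply p f t x
      = f x + ∫ s in (0 : ℝ)..t, semigroupApply p (generatorApply q nb f) s x := by
  set g := generatorApply q nb f with hg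
  have hgc := fun y => hp.continuous_semigroupApply hq hQf y
  set I : ℝ → S → ℝ := fun s y => ∫ r in (0 : ℝ)..s, semigroupApply p g r y with hI
  have hIder : ∀ s y, HasDerivAt (fun s => I s y) (semigroupApply p g s y) s := fun s y =>
    (hgc y).integral_hasStrictDerivAt 0 s |>.hasDerivAt
  have hIc : ∀ y, Continuous fun s => I s y := fun y =>
    continuous_iff_continuousAt.2 fun s => (hIder s y).continuousAt
  have hIb : ∀ s ∈ Icc 0 t, ∀ y, |I s y| ≤ C' * t := fun s hs y => by
    have h := intervalIntegral.norm_integral_le_of_norm_le_const (a := 0) (b := s)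
      (f := fun r => semigroupApply p g r y) (C := C')
      fun r _ => hp.abs_semigroupApply_le hQf r y
    rw [sub_zero, abs_of_nonneg hs.1] at h
    exact h.trans (mul_le_mul_of_nonneg_left hs.2 ((abs_nonneg _).trans (hQf y)))
  -- The generator is a finite sum, so it passes under the integral; the backward equation for `g`
  -- then evaluates the result.
  have hgen : ∀ s, 0 ≤ s → ∀ y, generatorApply q nb (I s) y = semigroupApply p g s y - g y :=
    fun s hs y => by
    rw [hq.semigroupApply_eq_integral hp hnb hself hQf y hs, add_sub_cancel_left]
    simp only [generatorApply, hI]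
    rw [intervalIntegral.integral_finsetSum
      (f := fun z r => q y z * (semigroupApply p g r z - semigroupApply p g r y)) fun z _ =>
      (continuous_const.mul ((hgc z).sub (hgc y))).intervalIntegrable _ _]
    refine Finset.sum_congr rfl fun z _ => ?_
    rw [intervalIntegral.integral_const_mul, intervalIntegral.integral_sub
      ((hgc z).intervalIntegrable _ _) ((hgc y).intervalIntegrable _ _)]
  have hgen2 : ∀ s, 0 ≤ s → ∀ y,
      generatorApply q nb (fun z => f z + I s z) y = semigroupApply p g s y := fun s hs y => by
    have h := generatorApply_sub_mul q nb f (I s) (-1) y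
    rw [hgen s hs y, show generatorApply q nb f y = g y from rfl] at h
    calc _ = generatorApply q nb (fun z => f z - -1 * I s z) y := by
          congr 1; ext z; ring
      _ = _ := by rw [h]; ring
  have hPder := fun s (hs : s ∈ Ioc 0 t) y => hq.hasDerivAt_semigroupApply hp hnb hself hf y hs.1
  have hPb := fun s y => hp.abs_semigroupApply_le hf s y
  -- The maximum principle is one-sided, so it is applied to the difference of the two solutions
  -- with both signs.
  have key : ∀ a : ℝ, |a| = 1 → a * (semigroupApply p f t x - (f x + I t x)) ≤ 0 := fun a ha => by
    refine nonpos_of_backward_subsolution (q := q) (nb := nb) (T := t) (C := C + (C + C' * t))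
      (v := fun s y => a * (semigroupApply p f s y - (f y + I s y)))
      (v' := fun s y => a * (generatorApply q nb (semigroupApply p f s) y - semigroupApply p g s y))
      hc hw hw0 hQw hq0
      (fun y => continuous_const.mul ((hp.continuous_semigroupApply hq hf y).sub
        (continuous_const.add (hIc y))))
      (fun s hs y => ((hPder s hs y).sub ((hIder s y).const_add (f y))).const_mul a)
      (fun s hs y => ?_) (fun s hs y => ?_) (fun y => ?_) ht x
    · rw [← hgen2 s hs.1.le y]
      simp only [generatorApply, Finset.mul_sum, ← Finset.sum_sub_distrib]
      exact (Finset.sum_congr rfl fun z _ => by ring).le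
    · refine (le_abs_self _).trans ?_
      rw [abs_mul, ha, one_mul]
      refine (abs_sub _ _).trans (add_le_add (hPb s y) ?_)
      exact (abs_add_le _ _).trans (add_le_add (hf y) (hIb s hs y))
    · simp [hp.semigroupApply_of_nonpos, hI]
  have h1 := key 1 (by simp)
  have h2 := key (-1) (by simp)
  linarith

theorem HasTransitionRates.hasDerivWithinAt_semigroupApply_forward (hp : IsTransitionFunction p)
    (hq : HasTransitionRates p q) (hnb : ∀ x y, y ∉ nb x → q x y = 0) (hself : ∀ x, x ∉ nb x)
    {w : S → ℝ} {c : ℝ} (hc : 0 ≤ c) (hw : ∀ M, {x | w x ≤ M}.Finite) (hw0 : ∀ x, 0 < w x)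
    (hQw : ∀ x, generatorApply q nb w x ≤ c * w x) (hq0 : ∀ x y, 0 ≤ q x y)
    {f : S → ℝ} {C : ℝ} (hf : ∀ y, |f y| ≤ C) {C' : ℝ} (hQf : ∀ y, |generatorApply q nb f y| ≤ C')
    {t : ℝ} (ht : 0 ≤ t) (x : S) :
    HasDerivWithinAt (fun t => semigroupApply p f t x)
      (semigroupApply p (generatorApply q nb f) t x) (Ici 0) t := by
  have h := ((hp.continuous_semigroupApply hq hQf x).integral_hasStrictDerivAt 0 t
    |>.hasDerivAt.const_add (f x)).hasDerivWithinAt (s := Ici 0)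
  have heq := fun s (hs : s ∈ Ici (0 : ℝ)) =>
    hq.semigroupApply_eq_integral_generatorApply hp hnb hself hc hw hw0 hQw hq0 hf hQf hs x
  exact h.congr heq (heq t ht)

end Comparison

/-! ### The star graph -/

namespace StarVertex

variable {d : ℕ}

/-- The distance from the origin. -/
def level : StarVertex d → ℕ
  | origin => 0
  | ray _ k => k + 1

/-- The states which can be reached from a given state in one jump. -/
def nbhd : StarVertex d → Finset (StarVertex d)
  | origin => Finset.univ.image fun j => ray j 0
  | ray j k => {ray j (k + 1), site j k}

theorem level_site (j : Fin d) (k : ℕ) : (site j k).level = k := by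
  cases k <;> rfl

/-- The star graph as the disjoint union of the origin and the semiaxes. -/
def equivSum (d : ℕ) : Unit ⊕ (ℕ × Fin d) ≃ StarVertex d where
  toFun := Sum.elim (fun _ => origin) fun z => ray z.2 z.1
  invFun
    | origin => Sum.inl ()
    | ray j k => Sum.inr (k, j)
  left_inv z := by rcases z with _ | _ <;> rfl
  right_inv v := by cases v <;> rfl

theorem rate_nonneg {α lam mu : ℝ} (hα : 0 ≤ α) (hlam : 0 ≤ lam) (hmu : 0 ≤ mu)
    (u v : StarVertex d) : 0 ≤ rate α lam mu u v := by
  rcases u with _ | ⟨i, k⟩ <;> rcases v with _ | ⟨j, l⟩ <;> simp only [rate] <;>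
    (try split_ifs) <;> positivity

theorem rate_eq_zero {α lam mu : ℝ} (u v : StarVertex d) (h : v ∉ nbhd u) :
    rate α lam mu u v = 0 := by
  rcases u with _ | ⟨i, k⟩ <;> rcases v with _ | ⟨j, l⟩
  · rfl
  · simp only [nbhd, Finset.mem_image, Finset.mem_univ, true_and, ray.injEq, not_exists] at h
    exact if_neg fun hl => h j ⟨rfl, hl.symm⟩
  · rcases k with _ | k
    · simp [nbhd, site] at h
    · simp [rate]
  · simp only [nbhd, Finset.mem_insert, Finset.mem_singleton, not_or, ray.injEq, not_and] at h
    simp only [rate]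
    rw [if_neg fun hc => h.1 hc.1.symm hc.2, if_neg]
    rintro ⟨rfl, rfl⟩
    exact h.2 rfl

theorem not_mem_nbhd_self (u : StarVertex d) : u ∉ nbhd u := by
  rcases u with _ | ⟨i, k⟩
  · simp [nbhd]
  · rcases k with _ | k <;> simp [nbhd, site]

theorem generatorApply_origin (α lam mu : ℝ) (f : StarVertex d → ℝ) :
    generatorApply (rate α lam mu) nbhd f origin = ∑ j, α * (f (ray j 0) - f origin) := by
  rw [generatorApply, nbhd, Finset.sum_image (by intro i _ j _ h; simpa using h)]
  simp [rate]

theorem generatorApply_ray (α lam mu : ℝ) (f : StarVertex d → ℝ) (j : Fin d) (k : ℕ) :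
    generatorApply (rate α lam mu) nbhd f (ray j k)
      = (α + lam * (k + 1)) * (f (ray j (k + 1)) - f (ray j k))
        + mu * (k + 1) * (f (site j k) - f (ray j k)) := by
  rw [generatorApply, nbhd, Finset.sum_pair (by rcases k with _ | k <;> simp [site]; omega)]
  rcases k with _ | k
  · simp [rate, site]
  · simp [rate, site, show k ≠ k + 1 + 1 by omega]

/-- The generator on functions of the distance from the origin. -/
noncomputable def levelGenerator (d : ℕ) (α lam mu : ℝ) (φ : ℕ → ℝ) : ℕ → ℝ
  | 0 => d * α * (φ 1 - φ 0)
  | k + 1 => (α + lam * (k + 1)) * (φ (k + 2) - φ (k + 1)) + mu * (k + 1) * (φ k - φ (k + 1))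

theorem generatorApply_level (α lam mu : ℝ) (φ : ℕ → ℝ) :
    generatorApply (rate α lam mu) nbhd (fun v : StarVertex d => φ v.level)
      = fun v => levelGenerator d α lam mu φ v.level := by
  ext v
  rcases v with _ | ⟨j, k⟩
  · rw [generatorApply_origin]
    simp [level, levelGenerator, mul_assoc]
  · rw [generatorApply_ray, level_site]
    rfl

theorem finite_level_le (M : ℝ) : {v : StarVertex d | (1 + v.level : ℝ) ≤ M}.Finite := by
  have hfin : ((equivSum d) '' (range Sum.inl ∪
      Sum.inr '' ((Finset.range ⌈M⌉₊ ×ˢ Finset.univ : Finset (ℕ × Fin d)) : Set _))).Finite :=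
    ((finite_range _).union ((Finset.finite_toSet _).image _)).image _
  refine hfin.subset fun v hv => ?_
  rcases v with _ | ⟨j, k⟩
  · exact ⟨Sum.inl (), Or.inl ⟨(), rfl⟩, rfl⟩
  · refine ⟨Sum.inr (k, j), Or.inr ⟨(k, j), ?_, rfl⟩, rfl⟩
    have h : (1 + ((k + 1 : ℕ) : ℝ)) ≤ M := hv
    have h2 : ((k + 2 : ℕ) : ℝ) ≤ ⌈M⌉₊ := by
      push_cast at h ⊢
      linarith [Nat.le_ceil M]
    have h3 : k + 2 ≤ ⌈M⌉₊ := by exact_mod_cast h2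
    simp only [Finset.coe_product, Finset.coe_range, Finset.coe_univ, mem_prod, mem_Iio, mem_univ,
      and_true]
    omega

theorem levelGenerator_lyapunov {α lam mu : ℝ} (hα : 0 ≤ α) (hlam : 0 ≤ lam) (hmu : 0 ≤ mu)
    (k : ℕ) : levelGenerator d α lam mu (fun k => 1 + (k : ℝ)) k
      ≤ (d * α + α + lam) * (1 + (k : ℝ)) := by
  rcases k with _ | k
  · simp only [levelGenerator]
    push_cast
    linarith
  · simp only [levelGenerator]
    push_cast
    have h1 : 0 ≤ (d : ℝ) * α * (2 + k) := by positivity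
    have h2 : 0 ≤ α * k := by positivity
    have h3 : 0 ≤ mu * (k + 1) := by positivity
    linarith

theorem hasSum_of_level {a : StarVertex d → ℝ} (ha : Summable a) :
    Summable (fun k => ∑ j, a (ray j k)) ∧
      ∑' v, a v = a origin + ∑' k, ∑ j, a (ray j k) := by
  have h1 : Summable (fun z => a (equivSum d z)) := (equivSum d).summable_iff.2 ha
  have h2 : Summable (fun z : ℕ × Fin d => a (ray z.2 z.1)) :=
    h1.comp_injective Sum.inr_injective
  have h3 : Summable (fun k => ∑' j, a (ray j k)) := h2.prod
  have h4 : ∑' v, a v = ∑' z, a (equivSum d z) := ((equivSum d).tsum_eq a).symm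
  have h5 := Summable.tsum_sum (f := fun z => a (equivSum d z))
    (h1.comp_injective Sum.inl_injective) h2
  have h6 := h2.tsum_prod
  simp only [tsum_fintype] at h3 h6
  refine ⟨h3, ?_⟩
  rw [h4, h5, ← h6]
  simp [equivSum]

end StarVertex

/-! ### The law of the walk and of its distance from the origin -/

section StarWalk

open StarVertex

variable {Ω : Type*} [MeasurableSpace Ω] {P : Measure Ω} {d : ℕ}
  {α lam mu : ℝ} {N : ℝ≥0 → Ω → StarVertex d}

/-- The expectation of a function of the distance from the origin. -/
noncomputable def levelMean (P : Measure Ω) (N : ℝ≥0 → Ω → StarVertex d) (φ : ℕ → ℝ) (t : ℝ) : ℝ :=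
  φ 0 * stateProb P N origin t + ∑' k : ℕ, φ (k + 1) * levelProb P N (k + 1) t

theorem levelProb_nonneg (k : ℕ) (t : ℝ) : 0 ≤ levelProb P N k t :=
  Finset.sum_nonneg fun _ _ => measureReal_nonneg

theorem summable_mul_levelProb_and_semigroupApply_eq
    {p : ℝ≥0 → StarVertex d → StarVertex d → ℝ} (hp : IsTransitionFunction p)
    (hs : ∀ v t, stateProb P N v t = p t.toNNReal origin v) {φ : ℕ → ℝ} {C : ℝ}
    (hφ : ∀ k, |φ k| ≤ C) (t : ℝ) :
    Summable (fun k => φ (k + 1) * levelProb P N (k + 1) t) ∧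
      semigroupApply p (fun v => φ v.level) t origin = levelMean P N φ t := by
  have h := hasSum_of_level (hp.summable_mul (f := fun v : StarVertex d => φ v.level)
    (fun v => hφ _) t.toNNReal origin)
  have h1 : ∀ k, ∑ j, p t.toNNReal origin (ray j k) * φ (ray j k).level
      = φ (k + 1) * levelProb P N (k + 1) t := fun k => by
    simp only [levelProb, hs, Finset.mul_sum, site, level]
    exact Finset.sum_congr rfl fun j _ => mul_comm _ _
  simp only [h1] at h
  refine ⟨h.1, ?_⟩
  rw [semigroupApply, h.2, levelMean, hs, mul_comm]
  rfl

variable [IsProbabilityMeasure P]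

/-- The Markov property is needed only at time `0` with the trivial event: the almost sure start
makes the conditioning disappear. -/
theorem stateProb_eq_of_markov (hstart : ∀ᵐ ω ∂P, N 0 ω = origin)
    {p : ℝ≥0 → StarVertex d → StarVertex d → ℝ}
    (hp : ∀ (s t : ℝ≥0) (A : Set Ω), MeasurableSet[pastOf N s] A → ∀ u v : StarVertex d,
      P.real (A ∩ {ω | N s ω = u} ∩ {ω | N (s + t) ω = v})
        = P.real (A ∩ {ω | N s ω = u}) * p t u v) (v : StarVertex d) (t : ℝ) :
    stateProb P N v t = p t.toNNReal origin v := by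
  have h := hp 0 t.toNNReal univ MeasurableSet.univ origin v
  rw [univ_inter, zero_add] at h
  have h1 : P.real {ω | N 0 ω = origin} = 1 := by
    rw [measureReal_congr (t := univ) (by
      filter_upwards [hstart] with ω hω
      exact propext ⟨fun _ => trivial, fun _ => hω⟩)]
    exact probReal_univ
  rw [h1, one_mul] at h
  rw [← h, stateProb]
  refine measureReal_congr ?_
  filter_upwards [hstart] with ω hω
  exact propext ⟨fun h => ⟨hω, h⟩, fun h => h.2⟩

namespace IsStarWalk

theorem exists_transition (hN : IsStarWalk P α lam mu N) :
    ∃ p : ℝ≥0 → StarVertex d → StarVertex d → ℝ, IsTransitionFunction p ∧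
      HasTransitionRates p (rate α lam mu) ∧
      ∀ v t, stateProb P N v t = p t.toNNReal origin v := by
  obtain ⟨p, hp, hq, h⟩ := hN.markov.markov
  exact ⟨p, hp, hq, stateProb_eq_of_markov hN.start h⟩

theorem summable_mul_levelProb (hN : IsStarWalk P α lam mu N) {φ : ℕ → ℝ} {C : ℝ}
    (hφ : ∀ k, |φ k| ≤ C) (t : ℝ) : Summable fun k => φ (k + 1) * levelProb P N (k + 1) t := by
  obtain ⟨p, hp, -, hs⟩ := hN.exists_transition
  exact (summable_mul_levelProb_and_semigroupApply_eq hp hs hφ t).1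

theorem summable_levelProb (hN : IsStarWalk P α lam mu N) (t : ℝ) :
    Summable fun k => levelProb P N (k + 1) t := by
  simpa using hN.summable_mul_levelProb (φ := fun _ => 1) (C := 1) (by simp) t

theorem stateProb_add_tsum_levelProb (hN : IsStarWalk P α lam mu N) (t : ℝ) :
    stateProb P N origin t + ∑' k, levelProb P N (k + 1) t = 1 := by
  obtain ⟨p, hp, -, hs⟩ := hN.exists_transition
  have h := (summable_mul_levelProb_and_semigroupApply_eq hp hs (φ := fun _ => 1) (C := 1)
    (by simp) t).2
  simpa [semigroupApply, levelMean, (hp.hasSum_one _ _).tsum_eq, eq_comm] using h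

theorem stateProb_zero (hN : IsStarWalk P α lam mu N) (v : StarVertex d) {t : ℝ} (ht : t ≤ 0) :
    stateProb P N v t = if v = origin then 1 else 0 := by
  obtain ⟨p, hp, -, hs⟩ := hN.exists_transition
  simp [hs, Real.toNNReal_of_nonpos ht, hp.zero, eq_comm]

theorem levelProb_le_one (hN : IsStarWalk P α lam mu N) (k : ℕ) (t : ℝ) :
    levelProb P N (k + 1) t ≤ 1 := by
  have h1 := (hN.summable_levelProb t).le_tsum k fun _ _ => levelProb_nonneg _ _
  have h2 := hN.stateProb_add_tsum_levelProb t
  have h3 : 0 ≤ stateProb P N origin t := measureReal_nonneg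
  linarith

theorem continuous_stateProb (hN : IsStarWalk P α lam mu N) (v : StarVertex d) :
    Continuous fun t => stateProb P N v t := by
  obtain ⟨p, hp, hq, hs⟩ := hN.exists_transition
  have h := hp.continuous_semigroupApply hq (f := fun u => if u = v then 1 else 0) (C := 1)
    (fun u => by split_ifs <;> simp) origin
  simpa [semigroupApply, hs] using h

theorem continuous_levelProb (hN : IsStarWalk P α lam mu N) (k : ℕ) :
    Continuous fun t => levelProb P N k t :=
  continuous_finsetSum _ fun _ _ => hN.continuous_stateProb _

/-- The distance from the origin has a finite mean. -/
theorem summable_succ_mul_levelProb (hN : IsStarWalk P α lam mu N) (hα : 0 ≤ α) (hlam : 0 ≤ lam)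
    (hmu : 0 ≤ mu) (t : ℝ) : Summable fun k : ℕ => (k + 1 : ℝ) * levelProb P N (k + 1) t := by
  obtain ⟨p, hp, hq, hs⟩ := hN.exists_transition
  have htt : ∀ k, levelProb P N k t = levelProb P N k (max t 0) := fun k => by
    rcases le_total t 0 with h | h <;> simp [levelProb, stateProb, h, Real.toNNReal_of_nonpos]
  simp only [htt]
  refine summable_of_sum_range_le (c := Real.exp ((d * α + α + lam) * max t 0))
    (fun k => mul_nonneg (by positivity) (levelProb_nonneg _ _)) fun n => ?_
  -- The truncated distance is bounded and lies below the Lyapunov function, so its mean is bounded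
  -- independently of `n`.
  set φ : ℕ → ℝ := fun k => if k ≤ n then (k : ℝ) else 0 with hφ
  have hb : ∀ k, |φ k| ≤ n := fun k => by
    simp only [hφ]
    split_ifs with h
    · rw [abs_of_nonneg (by positivity)]
      exact_mod_cast h
    · simp
  have h1 := (summable_mul_levelProb_and_semigroupApply_eq hp hs hb (max t 0)).2
  have h2 := hq.semigroupApply_le_exp_mul hp rate_eq_zero not_mem_nbhd_self
    (w := fun v : StarVertex d => 1 + (v.level : ℝ)) (c := d * α + α + lam) (by positivity)
    finite_level_le (fun v => by positivity)
    (fun v => by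
      rw [generatorApply_level α lam mu fun k => 1 + (k : ℝ)]
      exact levelGenerator_lyapunov hα hlam hmu _)
    (rate_nonneg hα hlam hmu) (f := fun v => φ v.level) (fun v => hb _)
    (fun v => by
      simp only [hφ]
      split_ifs
      · linarith
      · positivity)
    (le_max_right t 0) origin
  have h3 : levelMean P N φ (max t 0)
      = ∑ k ∈ Finset.range n, (k + 1 : ℝ) * levelProb P N (k + 1) (max t 0) := by
    rw [levelMean, tsum_eq_sum (s := Finset.range n)]
    · simp only [hφ]
      simp only [zero_le, if_true, Nat.cast_zero, zero_mul, zero_add]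
      refine Finset.sum_congr rfl fun k hk => ?_
      rw [if_pos (by have := Finset.mem_range.1 hk; omega)]
      push_cast
      rfl
    · intro k hk
      simp only [hφ]
      rw [if_neg (by have := Finset.mem_range.not.1 hk; omega), zero_mul]
  rw [← h3, ← h1]
  simpa [level] using h2

/-- The forward equation for functions of the distance from the origin. -/
theorem hasDerivWithinAt_levelMean (hN : IsStarWalk P α lam mu N) (hα : 0 ≤ α) (hlam : 0 ≤ lam)
    (hmu : 0 ≤ mu) {φ : ℕ → ℝ} {C C' : ℝ} (hφ : ∀ k, |φ k| ≤ C)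
    (hφ' : ∀ k, |levelGenerator d α lam mu φ k| ≤ C') {t : ℝ} (ht : 0 ≤ t) :
    HasDerivWithinAt (levelMean P N φ) (levelMean P N (levelGenerator d α lam mu φ) t)
      (Ici 0) t := by
  obtain ⟨p, hp, hq, hs⟩ := hN.exists_transition
  have h := hq.hasDerivWithinAt_semigroupApply_forward hp rate_eq_zero not_mem_nbhd_self
    (w := fun v : StarVertex d => 1 + (v.level : ℝ)) (c := d * α + α + lam) (by positivity)
    finite_level_le (fun v => by positivity)
    (fun v => by
      rw [generatorApply_level α lam mu fun k => 1 + (k : ℝ)]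
      exact levelGenerator_lyapunov hα hlam hmu _)
    (rate_nonneg hα hlam hmu) (f := fun v => φ v.level) (fun v => hφ _)
    (C' := C') (fun v => by rw [generatorApply_level]; exact hφ' _) ht origin
  rw [generatorApply_level, (summable_mul_levelProb_and_semigroupApply_eq hp hs hφ' t).2] at h
  exact h.congr (fun s _ => (summable_mul_levelProb_and_semigroupApply_eq hp hs hφ s).2.symm)
    (summable_mul_levelProb_and_semigroupApply_eq hp hs hφ t).2.symm

end IsStarWalk

end StarWalk

/-! ### The generating function -/

section GeneratingFunction

open StarVertex

variable {Ω : Type*} [MeasurableSpace Ω] {P : Measure Ω} {d : ℕ}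
  {α lam mu : ℝ} {N : ℝ≥0 → Ω → StarVertex d}

/-- The derivative of the generating function in its first argument. -/
noncomputable def genFunDeriv (P : Measure Ω) (N : ℝ≥0 → Ω → StarVertex d) (z t : ℝ) : ℝ :=
  ∑' k : ℕ, (k + 1 : ℝ) * z ^ k * levelProb P N (k + 1) t

/-- The right-hand side of the differential equation of the generating function. -/
noncomputable def genFunTimeDeriv (P : Measure Ω) (N : ℝ≥0 → Ω → StarVertex d) (α lam mu z t : ℝ) :
    ℝ :=
  -α * ((d : ℝ) - 1) * (1 - z) * stateProb P N origin t - α * (1 - z) * genFun P N z t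
    - (lam * z - mu) * (1 - z) * genFunDeriv P N z t

theorem genFun_eq_levelMean (z t : ℝ) : genFun P N z t = levelMean P N (fun k => z ^ k) t := by
  simp [genFun, levelMean]

theorem summable_succ_mul_pow {r : ℝ} (hr0 : 0 ≤ r) (hr : r < 1) :
    Summable fun k : ℕ => (k + 1 : ℝ) * r ^ k := by
  have h1 : ‖r‖ < 1 := by rwa [Real.norm_of_nonneg hr0]
  have h := (summable_pow_mul_geometric_of_norm_lt_one 1 h1).add (summable_geometric_of_norm_lt_one h1)
  refine h.congr fun k => ?_
  ring

variable [IsProbabilityMeasure P]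

namespace IsStarWalk

theorem genFun_one (hN : IsStarWalk P α lam mu N) (t : ℝ) : genFun P N 1 t = 1 := by
  simpa [genFun] using hN.stateProb_add_tsum_levelProb t

theorem genFun_initial (hN : IsStarWalk P α lam mu N) (z : ℝ) {t : ℝ} (ht : t ≤ 0) :
    genFun P N z t = 1 := by
  simp [genFun, levelProb, hN.stateProb_zero _ ht, site]

/-- The difference quotients of `z ^ (k + 1)` on `[-1, 1]` are at most `k + 1`, so the finite mean
allows dominated convergence up to the end points. The symmetric interval makes `z = 0` an interior
point. -/
theorem hasDerivWithinAt_genFun (hN : IsStarWalk P α lam mu N) (hα : 0 ≤ α) (hlam : 0 ≤ lam)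
    (hmu : 0 ≤ mu) {z : ℝ} (hz : z ∈ Icc (-1 : ℝ) 1) (t : ℝ) :
    HasDerivWithinAt (fun ζ => genFun P N ζ t) (genFunDeriv P N z t) (Icc (-1) 1) z := by
  have hsum : ∀ ζ ∈ Icc (-1 : ℝ) 1, Summable fun k : ℕ => ζ ^ (k + 1) * levelProb P N (k + 1) t :=
    fun ζ hζ => hN.summable_mul_levelProb (φ := fun k => ζ ^ k) (C := 1)
      (fun k => by
        rw [abs_pow]
        exact pow_le_one₀ (abs_nonneg _) (abs_le.2 hζ)) t
  have hd : HasDerivWithinAt (fun ζ : ℝ => ∑' k : ℕ, ζ ^ (k + 1) * levelProb P N (k + 1) t)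
      (genFunDeriv P N z t) (Icc (-1) 1) z := by
    rw [hasDerivWithinAt_iff_tendsto_slope]
    have hT : Tendsto (fun ζ : ℝ => ∑' k : ℕ, slope (fun ζ : ℝ => ζ ^ (k + 1)) z ζ
        * levelProb P N (k + 1) t) (𝓝[Icc (-1) 1 \ {z}] z) (𝓝 (genFunDeriv P N z t)) := by
      refine tendsto_tsum_of_dominated_convergence
        (hN.summable_succ_mul_levelProb hα hlam hmu t) (fun k => ?_) ?_
      · have h1 : HasDerivAt (fun ζ : ℝ => ζ ^ (k + 1)) ((k + 1 : ℝ) * z ^ k) z := by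
          simpa using hasDerivAt_pow (k + 1) z
        have h2 := hasDerivWithinAt_iff_tendsto_slope.1 (h1.hasDerivWithinAt (s := Icc (-1) 1))
        exact h2.mul_const _
      · filter_upwards [self_mem_nhdsWithin] with ζ hζ k
        have hm : 0 ≤ levelProb P N (k + 1) t := levelProb_nonneg _ _
        have hne : 0 < |ζ - z| := abs_pos.2 (sub_ne_zero.2 hζ.2)
        rw [norm_mul, Real.norm_of_nonneg hm, slope_def_field, norm_div, Real.norm_eq_abs,
          Real.norm_eq_abs]
        refine mul_le_mul_of_nonneg_right ?_ hm
        rw [div_le_iff₀ hne]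
        refine (abs_pow_sub_pow_le (a := ζ) (b := z) (n := k + 1)).trans ?_
        have h3 : max |ζ| |z| ^ (k + 1 - 1) ≤ 1 :=
          pow_le_one₀ (le_max_of_le_left (abs_nonneg _))
            (max_le (abs_le.2 hζ.1) (abs_le.2 hz))
        calc _ ≤ |ζ - z| * ((k + 1 : ℕ) : ℝ) * 1 := by gcongr
          _ = _ := by push_cast; ring
    refine hT.congr' ?_
    filter_upwards [self_mem_nhdsWithin] with ζ hζ
    rw [slope_def_field, ← (hsum ζ hζ.1).tsum_sub (hsum z hz), ← tsum_div_const]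
    refine tsum_congr fun k => ?_
    rw [slope_def_field]
    ring
  exact hd.const_add _

theorem hasDerivAt_genFun (hN : IsStarWalk P α lam mu N) (hα : 0 ≤ α) (hlam : 0 ≤ lam)
    (hmu : 0 ≤ mu) {z : ℝ} (hz : |z| < 1) (t : ℝ) :
    HasDerivAt (fun ζ => genFun P N ζ t) (genFunDeriv P N z t) z :=
  (hN.hasDerivWithinAt_genFun hα hlam hmu ⟨(abs_lt.1 hz).1.le, (abs_lt.1 hz).2.le⟩ t).hasDerivAt
    (Icc_mem_nhds (abs_lt.1 hz).1 (abs_lt.1 hz).2)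

/-- The forward equation applies to `k ↦ z ^ k`: its image under the generator is bounded because `k
* |z| ^ k` is, for `|z| < 1`. At level `0` the generator has `d * α` where the general pattern has
`α`, which produces the term with `d - 1`. -/
theorem hasDerivWithinAt_genFun_time (hN : IsStarWalk P α lam mu N) (hα : 0 ≤ α) (hlam : 0 ≤ lam)
    (hmu : 0 ≤ mu) {z : ℝ} (hz : |z| < 1) {t : ℝ} (ht : 0 ≤ t) :
    HasDerivWithinAt (fun s => genFun P N z s) (genFunTimeDeriv P N α lam mu z t) (Ici 0) t := by
  have hpow : ∀ k : ℕ, |z ^ k| ≤ 1 := fun k => by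
    rw [abs_pow]
    exact pow_le_one₀ (abs_nonneg _) hz.le
  set ψ := levelGenerator d α lam mu fun k => z ^ k with hψ
  have hψ0 : ψ 0 = d * α * (z - 1) := by simp [hψ, levelGenerator]
  have hψs : ∀ k : ℕ, ψ (k + 1) = -α * (1 - z) * z ^ (k + 1)
      - (lam * z - mu) * (1 - z) * ((k + 1 : ℝ) * z ^ k) := fun k => by
    simp only [hψ, levelGenerator]
    ring
  have hs := summable_succ_mul_pow (abs_nonneg z) hz
  obtain ⟨C, hC⟩ : ∃ C, ∀ k, |ψ k| ≤ C := by
    refine ⟨|ψ 0| + (|α * (1 - z)|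
      + |(lam * z - mu) * (1 - z)| * ∑' k : ℕ, (k + 1 : ℝ) * |z| ^ k), fun k => ?_⟩
    have hnn : 0 ≤ ∑' k : ℕ, (k + 1 : ℝ) * |z| ^ k := tsum_nonneg fun k => by positivity
    rcases k with _ | k
    · exact le_add_of_nonneg_right (by positivity)
    · refine le_add_of_nonneg_of_le (abs_nonneg _) ?_
      rw [hψs]
      refine (abs_sub _ _).trans (add_le_add ?_ ?_)
      · rw [neg_mul, neg_mul, abs_neg, abs_mul]
        exact mul_le_of_le_one_right (abs_nonneg _) (hpow _)
      · rw [abs_mul]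
        refine mul_le_mul_of_nonneg_left ?_ (abs_nonneg _)
        have h := hs.le_tsum k fun j _ => by positivity
        rwa [abs_mul, abs_pow, abs_of_nonneg (by positivity : (0 : ℝ) ≤ k + 1)]
  have h := hN.hasDerivWithinAt_levelMean hα hlam hmu hpow hC ht
  have hval : levelMean P N ψ t = genFunTimeDeriv P N α lam mu z t := by
    have h1 := hN.summable_mul_levelProb hpow t
    have h2 : Summable fun k : ℕ => (k + 1 : ℝ) * z ^ k * levelProb P N (k + 1) t := by
      refine Summable.of_norm_bounded hs fun k => ?_
      rw [norm_mul, norm_mul, norm_pow, Real.norm_of_nonneg (by positivity : (0 : ℝ) ≤ k + 1),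
        Real.norm_of_nonneg (levelProb_nonneg (P := P) (N := N) (k + 1) t), Real.norm_eq_abs]
      exact mul_le_of_le_one_right (by positivity) (hN.levelProb_le_one k t)
    have h3 := (h1.hasSum.mul_left (-α * (1 - z))).sub
      (h2.hasSum.mul_left ((lam * z - mu) * (1 - z)))
    rw [levelMean, genFunTimeDeriv, hψ0, genFun, genFunDeriv]
    have h4 := h3.tsum_eq
    rw [← tsum_congr (f := fun k => ψ (k + 1) * levelProb P N (k + 1) t)] at h4
    swap
    · intro k
      rw [hψs]
      ring
    rw [h4]
    ring
  rw [hval] at h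
  exact h.congr (fun s _ => genFun_eq_levelMean z s) (genFun_eq_levelMean z t)

theorem continuousAt_tsum_mul_levelProb (hN : IsStarWalk P α lam mu N) {φ : ℕ → ℝ → ℝ}
    (hφ : ∀ k, Continuous (φ k)) {b : ℕ → ℝ → ℝ} (hb : ∀ r, 0 ≤ r → r < 1 → Summable (b · r))
    (hφb : ∀ k r z, |z| ≤ r → |φ k z| ≤ b k r) {z : ℝ} (hz : |z| < 1) (t : ℝ) :
    ContinuousAt (fun v : ℝ × ℝ => ∑' k, φ k v.1 * levelProb P N (k + 1) v.2) (z, t) := by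
  obtain ⟨r, hzr, hr⟩ := exists_between hz
  have hopen : IsOpen {v : ℝ × ℝ | |v.1| < r} := isOpen_lt (by fun_prop) continuous_const
  refine (continuousOn_tsum (s := {v : ℝ × ℝ | |v.1| < r}) (fun k => ?_)
    (hb r ((abs_nonneg z).trans hzr.le) hr) fun k v hv => ?_).continuousAt
    (hopen.mem_nhds (show |z| < r from hzr))
  · exact (((hφ k).comp continuous_fst).mul
      ((hN.continuous_levelProb (k + 1)).comp continuous_snd)).continuousOn
  · have hm : 0 ≤ levelProb P N (k + 1) v.2 := levelProb_nonneg _ _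
    rw [norm_mul, Real.norm_of_nonneg hm, Real.norm_eq_abs]
    exact (mul_le_of_le_one_right (abs_nonneg _) (hN.levelProb_le_one k _)).trans
      (hφb k r v.1 (le_of_lt hv))

theorem continuousAt_genFun (hN : IsStarWalk P α lam mu N) {z : ℝ} (hz : |z| < 1) (t : ℝ) :
    ContinuousAt (fun v : ℝ × ℝ => genFun P N v.1 v.2) (z, t) := by
  refine ((hN.continuous_stateProb origin).comp continuous_snd).continuousAt.add ?_
  refine hN.continuousAt_tsum_mul_levelProb (φ := fun k z => z ^ (k + 1))
    (b := fun k r => r ^ (k + 1)) (fun k => by fun_prop) (fun r h0 h1 => ?_)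
    (fun k r z h => ?_) hz t
  · exact (summable_nat_add_iff 1).2 (summable_geometric_of_lt_one h0 h1)
  · rw [abs_pow]
    exact pow_le_pow_left₀ (abs_nonneg _) h _

theorem continuousAt_genFunDeriv (hN : IsStarWalk P α lam mu N) {z : ℝ} (hz : |z| < 1) (t : ℝ) :
    ContinuousAt (fun v : ℝ × ℝ => genFunDeriv P N v.1 v.2) (z, t) := by
  refine hN.continuousAt_tsum_mul_levelProb (φ := fun k z => (k + 1 : ℝ) * z ^ k)
    (b := fun k r => (k + 1 : ℝ) * r ^ k) (fun k => by fun_prop)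
    (fun r h0 h1 => summable_succ_mul_pow h0 h1) (fun k r z h => ?_) hz t
  rw [abs_mul, abs_pow, abs_of_nonneg (by positivity : (0 : ℝ) ≤ k + 1)]
  gcongr

theorem continuousAt_genFunTimeDeriv (hN : IsStarWalk P α lam mu N) {z : ℝ} (hz : |z| < 1)
    (t : ℝ) :
    ContinuousAt (fun v : ℝ × ℝ => genFunTimeDeriv P N α lam mu v.1 v.2) (z, t) := by
  have h1 := hN.continuousAt_genFun hz t
  have h2 := hN.continuousAt_genFunDeriv hz t
  have h3 : ContinuousAt (fun v : ℝ × ℝ => stateProb P N origin v.2) (z, t) :=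
    ((hN.continuous_stateProb origin).comp continuous_snd).continuousAt
  unfold genFunTimeDeriv
  fun_prop

/-- The chain rule for the generating function along a curve. -/
theorem hasDerivAt_genFun_comp (hN : IsStarWalk P α lam mu N) (hα : 0 ≤ α) (hlam : 0 ≤ lam)
    (hmu : 0 ≤ mu) {g : ℝ → ℝ} {g' y : ℝ} (hg : HasDerivAt g g' y) (hgy : |g y| < 1) (hy : 0 < y) :
    HasDerivAt (fun y => genFun P N (g y) y)
      (genFunDeriv P N (g y) y * g' + genFunTimeDeriv P N α lam mu (g y) y) y := by
  have hopen : IsOpen {v : ℝ × ℝ | |v.1| < 1 ∧ 0 < v.2} :=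
    (isOpen_lt (f := fun v : ℝ × ℝ => |v.1|) (by fun_prop) continuous_const).and
      (isOpen_lt continuous_const continuous_snd)
  have hnhds : {v : ℝ × ℝ | |v.1| < 1 ∧ 0 < v.2} ∈ 𝓝 (g y, y) := hopen.mem_nhds ⟨hgy, hy⟩
  have hL : Continuous fun a : ℝ => ContinuousLinearMap.toSpanSingleton ℝ a :=
    (ContinuousLinearMap.toSpanSingletonCLE (𝕜 := ℝ) (E := ℝ)).continuous
  -- Both partial derivatives exist near the point and are continuous at it, so the generating
  -- function is jointly differentiable there.
  have h := hasStrictFDerivAt_uncurry_coprod (𝕜 := ℝ) (u := (g y, y)) (f := genFun P N)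
    (f₁ := fun z t => ContinuousLinearMap.toSpanSingleton ℝ (genFunDeriv P N z t))
    (f₂ := fun z t => ContinuousLinearMap.toSpanSingleton ℝ (genFunTimeDeriv P N α lam mu z t))
    (by
      filter_upwards [hnhds] with v hv
      exact (hN.hasDerivAt_genFun hα hlam hmu hv.1 v.2).hasFDerivAt)
    (by
      filter_upwards [hnhds] with v hv
      exact ((hN.hasDerivWithinAt_genFun_time hα hlam hmu hv.1 hv.2.le).hasDerivAt
        (Ici_mem_nhds hv.2)).hasFDerivAt)
    (hL.continuousAt.comp (hN.continuousAt_genFunDeriv hgy y))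
    (hL.continuousAt.comp (hN.continuousAt_genFunTimeDeriv hgy y))
  have h2 := h.hasFDerivAt.comp_hasDerivAt (f := fun y => (g y, y)) y
    (hg.prodMk (hasDerivAt_id' y))
  refine h2.congr_deriv ?_
  simp [Function.HasUncurry.uncurry, mul_comm]

end IsStarWalk

end GeneratingFunction

/-! ### The explicit solution for a single semiaxis -/

section Explicit

/-- The integral of `exp (-θ y)` over `0 ≤ y ≤ s`. -/
noncomputable def expIntegral (θ s : ℝ) : ℝ :=
  if θ = 0 then s else (1 - Real.exp (-θ * s)) / θ

theorem mul_expIntegral (θ s : ℝ) : θ * expIntegral θ s = 1 - Real.exp (-θ * s) := by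
  unfold expIntegral
  split_ifs with h
  · simp [h]
  · field_simp

theorem hasDerivAt_exp_neg_mul (θ s : ℝ) :
    HasDerivAt (fun s => Real.exp (-θ * s)) (-θ * Real.exp (-θ * s)) s := by
  simpa [mul_comm] using ((hasDerivAt_id s).const_mul (-θ)).exp

theorem hasDerivAt_expIntegral (θ s : ℝ) :
    HasDerivAt (expIntegral θ) (Real.exp (-θ * s)) s := by
  by_cases h : θ = 0
  · subst h
    have h1 : expIntegral 0 = id := by ext s; simp [expIntegral]
    simpa [h1] using hasDerivAt_id s
  · have h1 := ((hasDerivAt_exp_neg_mul θ s).const_sub 1).div_const θ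
    have h2 : expIntegral θ = fun s => (1 - Real.exp (-θ * s)) / θ := by
      ext s; simp [expIntegral, h]
    rw [h2]
    refine h1.congr_deriv ?_
    rw [neg_mul, neg_neg, mul_div_cancel_left₀ _ h]

theorem expIntegral_zero (θ : ℝ) : expIntegral θ 0 = 0 := by
  simp [expIntegral]

theorem expIntegral_nonneg (θ : ℝ) {s : ℝ} (hs : 0 ≤ s) : 0 ≤ expIntegral θ s := by
  have hmono : Monotone (expIntegral θ) :=
    monotone_of_hasDerivAt_nonneg (hasDerivAt_expIntegral θ) fun s => (Real.exp_pos _).le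
  simpa [expIntegral_zero] using hmono hs

/-- The normalized denominator of the explicit solution. -/
noncomputable def hDenom (lam mu z s : ℝ) : ℝ :=
  Real.exp (-(lam - mu) * s) + lam * (1 - z) * expIntegral (lam - mu) s

/-- The characteristic curve of the differential equation of the generating function. -/
noncomputable def charCurve (lam mu z s : ℝ) : ℝ := 1 - (1 - z) / hDenom lam mu z s

variable {α lam mu z s : ℝ}

theorem hDenom_zero : hDenom lam mu z 0 = 1 := by simp [hDenom, expIntegral_zero]

theorem hasDerivAt_hDenom (lam mu z s : ℝ) : HasDerivAt (hDenom lam mu z)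
    ((lam * (1 - z) - (lam - mu)) * Real.exp (-(lam - mu) * s)) s := by
  have h := (hasDerivAt_exp_neg_mul (lam - mu) s).add
    ((hasDerivAt_expIntegral (lam - mu) s).const_mul (lam * (1 - z)))
  refine h.congr_deriv ?_
  ring

theorem hDenom_pos (hlam : 0 < lam) (hz : z ≤ 1) (hs : 0 ≤ s) : 0 < hDenom lam mu z s := by
  have h1 := expIntegral_nonneg (lam - mu) hs
  have h2 : 0 ≤ 1 - z := by linarith
  have h3 := Real.exp_pos (-(lam - mu) * s)
  unfold hDenom
  positivity

/-- Dividing the denominator of `hFun` by `lam - mu` gives a quantity that stays positive for `0 ≤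
s`, `z ≤ 1` and covers the case `lam = mu`. Both branches of `hFun` thus become one formula. -/
theorem sub_mul_hDenom (lam mu z s : ℝ) : (lam - mu) * hDenom lam mu z s
    = lam * (1 - z) - (mu - lam * z) * Real.exp (-(lam - mu) * s) := by
  have h := mul_expIntegral (lam - mu) s
  unfold hDenom
  linear_combination lam * (1 - z) * h

theorem hFun_eq_rpow (h : 0 ≤ hDenom lam mu z s) :
    hFun α lam mu s z = (Real.exp (-(lam - mu) * s) / hDenom lam mu z s) ^ (α / lam) := by
  unfold hFun
  split_ifs with heq
  · subst heq
    have h1 : hDenom lam lam z s = 1 + lam * s * (1 - z) := by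
      simp [hDenom, expIntegral]; ring
    rw [h1] at h ⊢
    simp [Real.inv_rpow h]
  · rw [← sub_mul_hDenom, mul_div_mul_left _ _ (sub_ne_zero.2 heq)]

/-- The base of the power has logarithmic derivative `-lam * (1 - z) / hDenom`, and the exponent
turns `lam` into `α`. Positivity of `hDenom` is an open condition, so the derivative is two-sided
even at `s = 0`. -/
theorem hasDerivAt_hFun (hlam : 0 < lam) (hR : 0 < hDenom lam mu z s) :
    HasDerivAt (fun s => hFun α lam mu s z)
      (-α * ((1 - z) / hDenom lam mu z s) * hFun α lam mu s z) s := by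
  set E := Real.exp (-(lam - mu) * s) with hE
  have hE0 : 0 < E := Real.exp_pos _
  have h1 := (hasDerivAt_exp_neg_mul (lam - mu) s).div (hasDerivAt_hDenom lam mu z s) hR.ne'
  have h2 := h1.rpow_const (p := α / lam) (Or.inl (div_pos hE0 hR).ne')
  have hev : (fun s => hFun α lam mu s z) =ᶠ[𝓝 s]
      fun s => (Real.exp (-(lam - mu) * s) / hDenom lam mu z s) ^ (α / lam) := by
    filter_upwards [(hasDerivAt_hDenom lam mu z s).continuousAt.eventually (lt_mem_nhds hR)]
      with r hr
    exact hFun_eq_rpow hr.le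
  refine (h2.congr_of_eventuallyEq hev).congr_deriv ?_
  rw [hFun_eq_rpow hR.le]
  simp only [Pi.div_apply]
  rw [← hE, Real.rpow_sub_one (div_pos hE0 hR).ne']
  have h3 := sub_mul_hDenom lam mu z s
  have h4 : -(lam - mu) * E * hDenom lam mu z s
      - E * ((lam * (1 - z) - (lam - mu)) * E) = - (E * (lam * (1 - z))) := by
    rw [← hE] at h3
    linear_combination -E * h3
  rw [h4]
  field_simp

theorem hFun_zero : hFun α lam mu 0 z = 1 := by
  rw [hFun_eq_rpow (by rw [hDenom_zero]; exact zero_le_one)]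
  simp [hDenom_zero]

theorem charCurve_zero : charCurve lam mu z 0 = z := by simp [charCurve, hDenom_zero]

theorem hasDerivAt_charCurve (hR : 0 < hDenom lam mu z s) : HasDerivAt (charCurve lam mu z)
    ((mu - lam * charCurve lam mu z s) * (1 - charCurve lam mu z s)) s := by
  have h := (((hasDerivAt_const s (1 - z)).div (hasDerivAt_hDenom lam mu z s) hR.ne').const_sub 1)
  refine h.congr_deriv ?_
  have h3 := sub_mul_hDenom lam mu z s
  unfold charCurve
  generalize Real.exp (-(lam - mu) * s) = E at h3 ⊢
  field_simp
  linear_combination (1 - z) * h3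

theorem charCurve_nonneg (hlam : 0 < lam) (hmu : 0 < mu) (hz : z ∈ Icc (0 : ℝ) 1) (hs : 0 ≤ s) :
    0 ≤ charCurve lam mu z s := by
  have hR := hDenom_pos (mu := mu) hlam hz.2 hs
  rw [charCurve, sub_nonneg, div_le_one hR]
  have h1 := expIntegral_nonneg (lam - mu) hs
  have h2 : 0 ≤ 1 - z := by linarith [hz.2]
  have h3 := mul_expIntegral (lam - mu) s
  have h4 := mul_nonneg hz.1 (Real.exp_pos (-(lam - mu) * s)).le
  have h5 : 0 ≤ mu * (1 - z) * expIntegral (lam - mu) s := by positivity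
  unfold hDenom
  -- The difference `hDenom - (1 - z)` equals `z * exp (-(lam - mu) * s) + mu * (1 - z) *
  -- expIntegral (lam - mu) s`.
  nlinarith

theorem charCurve_lt_one (hlam : 0 < lam) (hz : z < 1) (hs : 0 ≤ s) :
    charCurve lam mu z s < 1 :=
  sub_lt_self _ (div_pos (sub_pos.2 hz) (hDenom_pos hlam hz.le hs))

theorem deriv_hFun (hlam : 0 < lam) (hz : z ≤ 1) (hs : 0 ≤ s) :
    deriv (fun s => hFun α lam mu s z) s
      = -α * (1 - charCurve lam mu z s) * hFun α lam mu s z := by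
  rw [(hasDerivAt_hFun hlam (hDenom_pos hlam hz hs)).deriv, charCurve, sub_sub_cancel]

theorem continuousOn_deriv_hFun (hlam : 0 < lam) (hz : z ≤ 1) :
    ContinuousOn (deriv fun s => hFun α lam mu s z) (Ici 0) := by
  have h1 : ContinuousOn (charCurve lam mu z) (Ici 0) := fun s hs =>
    (hasDerivAt_charCurve (hDenom_pos hlam hz hs)).continuousAt.continuousWithinAt
  have h2 : ContinuousOn (fun s => hFun α lam mu s z) (Ici 0) := fun s hs =>
    (hasDerivAt_hFun hlam (hDenom_pos hlam hz hs)).continuousAt.continuousWithinAt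
  exact ((continuousOn_const.mul (continuousOn_const.sub h1)).mul h2).congr fun s hs =>
    deriv_hFun hlam hz hs

end Explicit

/-! ### The integral formula -/

section Main

open StarVertex

variable {Ω : Type*} [MeasurableSpace Ω] {P : Measure Ω} [IsProbabilityMeasure P] {d : ℕ}
  {α lam mu : ℝ} {N : ℝ≥0 → Ω → StarVertex d}

namespace IsStarWalk

theorem intervalIntegrable_deriv_hFun_mul (hN : IsStarWalk P α lam mu N) (hlam : 0 < lam) {z : ℝ}
    (hz : z ≤ 1) {t : ℝ} (ht : 0 ≤ t) :
    IntervalIntegrable (fun y => deriv (fun s => hFun α lam mu s z) (t - y)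
      * stateProb P N origin y) volume 0 t := by
  refine ContinuousOn.intervalIntegrable ?_
  rw [uIcc_of_le ht]
  refine ContinuousOn.mul ?_ (hN.continuous_stateProb origin).continuousOn
  exact (continuousOn_deriv_hFun hlam hz).comp (by fun_prop) fun y hy => sub_nonneg.2 hy.2

theorem genFun_eq_add_integral (hN : IsStarWalk P α lam mu N) (hα : 0 < α) (hlam : 0 < lam)
    (hmu : 0 < mu) {z : ℝ} (hz : z ∈ Icc (0 : ℝ) 1) {t : ℝ} (ht : 0 ≤ t) :
    genFun P N z t = hFun α lam mu t z
      + ((d : ℝ) - 1) * ∫ y in (0 : ℝ)..t, deriv (fun s => hFun α lam mu s z) (t - y)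
          * stateProb P N origin y := by
  have hint := hN.intervalIntegrable_deriv_hFun_mul hlam hz.2 ht
  rw [← intervalIntegral.integral_const_mul]
  -- At `z = 1` the characteristic stays at `1`, outside the disc where the chain rule is available;
  -- there `F = H = 1` and `H' = 0`.
  rcases hz.2.eq_or_lt with rfl | hz1
  · have h0 : ∀ s, 0 ≤ s → charCurve lam mu 1 s = 1 := fun s _ => by simp [charCurve]
    have h1 : hFun α lam mu t 1 = 1 := by
      rw [hFun_eq_rpow (hDenom_pos hlam le_rfl ht).le]
      simp [hDenom]
    rw [hN.genFun_one, h1, intervalIntegral.integral_congr (g := fun _ => (0 : ℝ))]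
    · simp
    · intro y hy
      rw [uIcc_of_le ht] at hy
      have hy' := sub_nonneg.2 hy.2
      simp [deriv_hFun hlam le_rfl hy', h0 _ hy']
  · set g := charCurve lam mu z with hg
    have hgabs : ∀ s, 0 ≤ s → |g s| < 1 := fun s hs => by
      rw [abs_of_nonneg (charCurve_nonneg hlam hmu hz hs)]
      exact charCurve_lt_one hlam hz1 hs
    have hsub : ∀ y, HasDerivAt (fun y => t - y) (-1) y := fun y =>
      (hasDerivAt_id y).const_sub t
    have hgd : ∀ y, y ≤ t → HasDerivAt (fun y => g (t - y))
        ((mu - lam * g (t - y)) * (1 - g (t - y)) * -1) y := fun y hy =>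
      (hasDerivAt_charCurve (hDenom_pos hlam hz.2 (sub_nonneg.2 hy))).comp y (hsub y)
    have hhd : ∀ y, y ≤ t → HasDerivAt (fun y => hFun α lam mu (t - y) z)
        (deriv (fun s => hFun α lam mu s z) (t - y) * -1) y := fun y hy =>
      (hasDerivAt_hFun hlam (hDenom_pos hlam hz.2 (sub_nonneg.2 hy))).differentiableAt.hasDerivAt.comp
        y (hsub y)
    have hcont : ContinuousOn (fun y => hFun α lam mu (t - y) z * genFun P N (g (t - y)) y)
        (Icc 0 t) := fun y hy => by
      refine ContinuousAt.continuousWithinAt ((hhd y hy.2).continuousAt.mul ?_)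
      have hc : ContinuousAt (fun y => (g (t - y), y)) y :=
        (hgd y hy.2).continuousAt.prodMk continuousAt_id
      exact ContinuousAt.comp (f := fun y => (g (t - y), y))
        (g := fun v : ℝ × ℝ => genFun P N v.1 v.2)
        (hN.continuousAt_genFun (hgabs _ (sub_nonneg.2 hy.2)) y) hc
    -- Time runs backwards along the characteristic, so its velocity cancels the transport term, and
    -- the derivative of `H` cancels the term in `F`.
    have hder : ∀ y ∈ Ioo 0 t, HasDerivAt
        (fun y => hFun α lam mu (t - y) z * genFun P N (g (t - y)) y)
        (((d : ℝ) - 1) * (deriv (fun s => hFun α lam mu s z) (t - y) * stateProb P N origin y)) y :=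
      fun y hy => by
      have hty := sub_nonneg.2 hy.2.le
      have h := (hhd y hy.2.le).mul (hN.hasDerivAt_genFun_comp hα.le hlam.le hmu.le
        (hgd y hy.2.le) (hgabs _ hty) hy.1)
      refine h.congr_deriv ?_
      rw [deriv_hFun hlam hz.2 hty, genFunTimeDeriv]
      ring
    rw [intervalIntegral.integral_eq_sub_of_hasDerivAt_of_le ht hcont hder (hint.const_mul _)]
    rw [sub_self, sub_zero, hFun_zero, hg, charCurve_zero, hN.genFun_initial _ le_rfl]
    ring

end IsStarWalk

end Main

theorem mainTheorem7 {Ω : Type*} [MeasurableSpace Ω] (P : Measure Ω) [IsProbabilityMeasure P]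
    (d : ℕ) (hd : 1 ≤ d) (α lam mu : ℝ) (hα : 0 < α) (hlam : 0 < lam) (hmu : 0 < mu)
    (N : ℝ≥0 → Ω → StarVertex d) (hN : IsStarWalk P α lam mu N) :
    -- `F` solves the differential equation, with its initial and boundary conditions
    (∀ z ∈ Icc (0 : ℝ) 1, ∀ t : ℝ, 0 ≤ t → ∃ Fz : ℝ,
      HasDerivWithinAt (fun ζ => genFun P N ζ t) Fz (Icc 0 1) z ∧
      HasDerivWithinAt (fun s => genFun P N z s)
        (-α * ((d : ℝ) - 1) * (1 - z) * stateProb P N StarVertex.origin t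
          - α * (1 - z) * genFun P N z t - (lam * z - mu) * (1 - z) * Fz) (Ici 0) t) ∧
    (∀ z ∈ Icc (0 : ℝ) 1, genFun P N z 0 = 1) ∧
    (∀ t : ℝ, 0 ≤ t → genFun P N 1 t = 1) ∧
    -- the formula for `F`; here `H = fun s => hFun α lam mu s z`
    (∀ z ∈ Icc (0 : ℝ) 1, ∀ t : ℝ, 0 ≤ t →
      DifferentiableAt ℝ (fun s => hFun α lam mu s z) t ∧
      IntervalIntegrable (fun y => deriv (fun s => hFun α lam mu s z) (t - y)
        * stateProb P N StarVertex.origin y) volume 0 t ∧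
      genFun P N z t = hFun α lam mu t z
        + ((d : ℝ) - 1) * ∫ y in (0 : ℝ)..t, deriv (fun s => hFun α lam mu s z) (t - y)
            * stateProb P N StarVertex.origin y) ∧
    -- the Volterra integral equation for `p(0, t)`
    (∀ t : ℝ, 0 < t →
      IntervalIntegrable (fun y => deriv (GFun α lam mu) (t - y)
        * stateProb P N StarVertex.origin y) volume 0 t ∧
      stateProb P N StarVertex.origin t = 1 - GFun α lam mu t
        - ((d : ℝ) - 1) * ∫ y in (0 : ℝ)..t, deriv (GFun α lam mu) (t - y)
            * stateProb P N StarVertex.origin y) := by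
  have hformula : ∀ z ∈ Icc (0 : ℝ) 1, ∀ t : ℝ, 0 ≤ t →
      DifferentiableAt ℝ (fun s => hFun α lam mu s z) t ∧
      IntervalIntegrable (fun y => deriv (fun s => hFun α lam mu s z) (t - y)
        * stateProb P N StarVertex.origin y) volume 0 t ∧
      genFun P N z t = hFun α lam mu t z
        + ((d : ℝ) - 1) * ∫ y in (0 : ℝ)..t, deriv (fun s => hFun α lam mu s z) (t - y)
            * stateProb P N StarVertex.origin y := fun z hz t ht =>
    ⟨(hasDerivAt_hFun hlam (hDenom_pos hlam hz.2 ht)).differentiableAt,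
      hN.intervalIntegrable_deriv_hFun_mul hlam hz.2 ht,
      hN.genFun_eq_add_integral hα hlam hmu hz ht⟩
  refine ⟨fun z hz t ht => ⟨genFunDeriv P N z t, ?_, ?_⟩, fun z _ => hN.genFun_initial z le_rfl,
    fun t _ => hN.genFun_one t, hformula, fun t ht => ?_⟩
  · exact (hN.hasDerivWithinAt_genFun hα.le hlam.le hmu.le ⟨by linarith [hz.1], hz.2⟩ t).mono
      (Icc_subset_Icc_left (by norm_num))
  · rcases hz.2.eq_or_lt with rfl | hz1
    -- Every term on the right carries the factor `1 - z`, and `F` is constant in time at `z = 1`.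
    · simpa [hN.genFun_one] using hasDerivWithinAt_const t (Ici (0 : ℝ)) (1 : ℝ)
    · exact hN.hasDerivWithinAt_genFun_time hα.le hlam.le hmu.le
        (by rwa [abs_of_nonneg hz.1]) ht
  · obtain ⟨-, hint, heq⟩ := hformula 0 (by simp) t ht.le
    have hG : deriv (GFun α lam mu) = fun s => -deriv (fun s => hFun α lam mu s 0) s := by
      ext s
      exact deriv_const_sub 1
    have h0 : genFun P N 0 t = stateProb P N StarVertex.origin t := by simp [genFun]
    simp only [hG, neg_mul]
    refine ⟨hint.neg, ?_⟩
    rw [intervalIntegral.integral_neg, ← h0, heq, GFun]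
    ring
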